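/- Let $\Gamma$ be a finite bipartite distance-regular graph with vertex set $X$, path-length distance $\partial$, diameter $D\ge 4$, valency $k\ge 3$ and intersection numbers $p^h_{ij}$ (the number of vertices $z$ with $\partial(x,z)=i$ and $\partial(z,y)=j$, for any $x,y$ with $\partial(x,y)=h$). Write $b_i=p^i_{1,i+1}$, $c_i=p^i_{1,i-1}$, let $\theta_0>\theta_1>\cdots>\theta_D$ be the distinct eigenvalues of the adjacency matrix of $\Gamma$, and set $d=\lfloor D/2\rfloor$ and $$\Delta=(k-2)(c_3-1)-(c_2-1)\,p^2_{22},\qquad \tilde\theta_n=-1-\frac{b_2b_3}{\theta_n^2-b_2}\quad(n\in\{1,d\})$$ (one has $\theta_1^2>b_2>\theta_d^2$). The graph $\Gamma$ is called taut if $\Delta\neq 0$ and $$b_3\bigl(b_2(k-2)-(c_2-1)\theta_1^2\bigr)\bigl(b_2(k-2)-(c_2-1)\theta_d^2\bigr)=b_1\Delta(\theta_1^2-b_2)(b_2-\theta_d^2).$$ For $x\in X$ let $\Gamma_2^2(x)$ be the graph on $\{y\in X:\partial(x,y)=2\}$ in which $y,z$ are adjacent if and only if $\partial(y,z)=2$,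 and let $\eta_1,\dots,\eta_{k_2}$ (with $k_2=p^0_{22}$) be the eigenvalues of its adjacency matrix, with multiplicity, ordered (as is always possible) so that $\eta_1=p^2_{22}$ and $\eta_i=b_3-1$ for $2\le i\le k$. The graph $\Gamma$ is called spectrally taut with respect to $x$ if $\eta_i\in\{\tilde\theta_1,\tilde\theta_d\}$ for all $i$ with $k+1\le i\le k_2$. Then the following are equivalent: (i) $\Gamma$ is taut; (ii) $\Delta\neq 0$ and $\Gamma$ is spectrally taut with respect to every vertex; (iii) $\Delta\neq 0$ and $\Gamma$ is spectrally taut with respect to at least one vertex. -/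

import Mathlib

namespace SimpleGraph

/-- The number of vertices `z` with `∂(x, z) = i` and `∂(z, y) = j`. -/
noncomputable def distCount {V : Type*} (G : SimpleGraph V) (x y : V) (i j : ℕ) : ℕ :=
  {z : V | G.dist x z = i ∧ G.dist z y = j}.ncard

/-- A graph is distance-regular if it is connected and the number of vertices at distance `i` from
`x` and `j` from `y` depends only on `i`, `j` and the distance between `x` and `y`. -/
def IsDistanceRegular {V : Type*} (G : SimpleGraph V) : Prop :=
  G.Connected ∧ ∀ x y x' y' : V, G.dist x y = G.dist x' y' →
    ∀ i j : ℕ, G.distCount x y i j = G.distCount x' y' i j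

open Classical in
/-- The intersection number `p^h_{ij}`: the value of `distCount x y i j` at a pair `x, y` at
distance `h` (zero if there is no such pair). For a distance-regular graph it does not depend on the
pair, see `IsDistanceRegular.distCount_eq`. -/
noncomputable def intersectionNumber {V : Type*} (G : SimpleGraph V) (h i j : ℕ) : ℕ :=
  if H : ∃ q : V × V, G.dist q.1 q.2 = h then G.distCount H.choose.1 H.choose.2 i j else 0

theorem IsDistanceRegular.distCount_eq {V : Type*} {G : SimpleGraph V} (hG : G.IsDistanceRegular)
    {x y : V} {h : ℕ} (hxy : G.dist x y = h) (i j : ℕ) :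
    G.distCount x y i j = G.intersectionNumber h i j := by
  have H : ∃ q : V × V, G.dist q.1 q.2 = h := ⟨(x, y), hxy⟩
  rw [intersectionNumber, dif_pos H]
  exact hG.2 _ _ _ _ (hxy.trans H.choose_spec.symm) i j

/-- `b_i = p^i_{1,i+1}`. -/
noncomputable def interB {V : Type*} (G : SimpleGraph V) (i : ℕ) : ℕ :=
  G.intersectionNumber i 1 (i + 1)

/-- `c_i = p^i_{1,i-1}`, used for `i ≥ 1`. -/
noncomputable def interC {V : Type*} (G : SimpleGraph V) (i : ℕ) : ℕ :=
  G.intersectionNumber i 1 (i - 1)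

/-- The valency `k = b_0`. -/
noncomputable def valency {V : Type*} (G : SimpleGraph V) : ℕ := G.interB 0

open Classical in
/-- `θ_i`, where `θ_0 > θ_1 > ⋯` are the distinct eigenvalues of the adjacency matrix. -/
noncomputable def theta {V : Type*} [Fintype V] (G : SimpleGraph V) (i : ℕ) : ℝ :=
  ((G.adjMatrix ℝ).charpoly.roots.toFinset.sort (· ≥ ·)).getD i 0

/-- `z̃ = -1 - b_2 b_3 / (z^2 - b_2)`, for real `z` with `z^2 ≠ b_2`. -/
noncomputable def tilde {V : Type*} (G : SimpleGraph V) (z : ℝ) : ℝ :=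
  -1 - (G.interB 2 : ℝ) * G.interB 3 / (z ^ 2 - G.interB 2)

/-- `Δ = (k - 2)(c_3 - 1) - (c_2 - 1) p^2_{22}`. -/
noncomputable def tautDelta {V : Type*} (G : SimpleGraph V) : ℝ :=
  ((G.valency : ℝ) - 2) * ((G.interC 3 : ℝ) - 1)
    - ((G.interC 2 : ℝ) - 1) * (G.intersectionNumber 2 2 2 : ℝ)

/-- With `d = ⌊D/2⌋`, the graph is taut if `Δ ≠ 0` and
`b_3 (b_2(k-2) - (c_2-1)θ_1^2) (b_2(k-2) - (c_2-1)θ_d^2) = b_1 Δ (θ_1^2 - b_2) (b_2 - θ_d^2)`. -/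
def IsTaut {V : Type*} [Fintype V] (G : SimpleGraph V) : Prop :=
  G.tautDelta ≠ 0 ∧
    (G.interB 3 : ℝ)
        * ((G.interB 2 : ℝ) * ((G.valency : ℝ) - 2)
            - ((G.interC 2 : ℝ) - 1) * G.theta 1 ^ 2)
        * ((G.interB 2 : ℝ) * ((G.valency : ℝ) - 2)
            - ((G.interC 2 : ℝ) - 1) * G.theta (G.diam / 2) ^ 2)
      = (G.interB 1 : ℝ) * G.tautDelta * (G.theta 1 ^ 2 - G.interB 2)
        * ((G.interB 2 : ℝ) - G.theta (G.diam / 2) ^ 2)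

/-- The graph `Γ_2^2(x)` on the vertices at distance 2 from `x`, two of them being adjacent when
they are at distance 2 in the original graph. -/
def secondSubconstituent {V : Type*} (G : SimpleGraph V) (x : V) :
    SimpleGraph {y : V // G.dist x y = 2} where
  Adj y z := G.dist (y : V) (z : V) = 2
  symm := ⟨fun y z h => by rw [G.dist_comm]; exact h⟩
  loopless := ⟨fun y h => by simp at h⟩

open Classical in
/-- The multiset `η_1, …, η_{k_2}` of local eigenvalues with respect to `x`: the eigenvalues of the
adjacency matrix of `Γ_2^2(x)`, with multiplicity. -/
noncomputable def localEigenvalues {V : Type*} [Fintype V] (G : SimpleGraph V) (x : V) :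
    Multiset ℝ :=
  ((G.secondSubconstituent x).adjMatrix ℝ).charpoly.roots

/-- The local eigenvalues `η_{k+1}, …, η_{k_2}`, when the local eigenvalues are ordered so that
`η_1 = p^2_{22}` and `η_i = b_3 - 1` for `2 ≤ i ≤ k`: what is left of the multiset of local
eigenvalues once `p^2_{22}` has been removed once and `b_3 - 1` has been removed `k - 1` times. -/
noncomputable def remainingLocalEigenvalues {V : Type*} [Fintype V] (G : SimpleGraph V) (x : V) :
    Multiset ℝ :=
  G.localEigenvalues x
    - ((G.intersectionNumber 2 2 2 : ℝ) ::ₘ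
        Multiset.replicate (G.valency - 1) ((G.interB 3 : ℝ) - 1))

/-- Every `η_i` with `k + 1 ≤ i ≤ k_2` is one of `θ̃_1`, `θ̃_d`, where `d = ⌊D/2⌋`. -/
def IsSpectrallyTautAt {V : Type*} [Fintype V] (G : SimpleGraph V) (x : V) : Prop :=
  ∀ η ∈ G.remainingLocalEigenvalues x,
    η = G.tilde (G.theta 1) ∨ η = G.tilde (G.theta (G.diam / 2))

end SimpleGraph

/-! Fix a vertex `x` and let `T` be the adjacency matrix of `Γ_2^2(x)`. The column space of the
incidence matrix `N` between `Γ_2(x)` and `Γ(x)` is `T`-invariant and carries the eigenvalues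
`p^2_{22}` (once) and `b_3 - 1` (`k - 1` times). By symmetry of `T`, the remaining local eigenvalues
come from eigenvectors `v` with `Nᵀ v = 0` (`localEigenvalues_eq`).

For an eigenvalue `t ≠ ±k` of the graph, a positive multiple of the projection to its eigenspace is
positive semidefinite with entries depending only on distance. Evaluating its quadratic form at `v`
gives `b_2 b_3 + (t² - b_2)(1 + η) ≥ 0` (`local_eigenvalue_bound`). Since `θ_d² < b_2 < θ_1²`, the
choices `t = θ_1, θ_d` confine `η` to `[θ̃_1, θ̃_d]`.

So every term `(η - θ̃_1)(η - θ̃_d)` is nonpositive, and their sum vanishes exactly when the graph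
is spectrally taut at `x`. The traces of `T` and `T²` express this sum by `θ_1`, `θ_d` and
intersection numbers, so it is independent of `x`. Up to a nonzero factor it is the difference of
the two sides of the tautness equation (`tautness_identity`). -/

namespace SimpleGraph

variable {V : Type*} {G : SimpleGraph V}

/-! ### Distances in connected bipartite graphs -/

theorem IsBipartite.exists_bool_coloring (hbip : G.IsBipartite) : Nonempty (G.Coloring Bool) := by
  obtain ⟨c⟩ := hbip
  exact ⟨recolorOfEquiv G finTwoEquiv c⟩

theorem Coloring.even_dist_iff (hc : G.Connected) (c : G.Coloring Bool) (u v : V) :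
    Even (G.dist u v) ↔ (c u ↔ c v) := by
  obtain ⟨p, hp⟩ := hc.exists_walk_length_eq_dist u v
  rw [← hp, c.even_length_iff_congr p]

theorem IsBipartite.even_dist_add (hbip : G.IsBipartite) (hc : G.Connected) (u v w : V) :
    Even (G.dist u v + G.dist v w + G.dist u w) := by
  obtain ⟨c⟩ := hbip.exists_bool_coloring
  have h1 := c.even_dist_iff hc u v
  have h2 := c.even_dist_iff hc v w
  have h3 := c.even_dist_iff hc u w
  rw [Nat.even_add, Nat.even_add, h1, h2, h3]
  tauto

theorem IsBipartite.dist_adj (hbip : G.IsBipartite) (hc : G.Connected) {x z : V}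
    (h : G.Adj x z) (y : V) :
    G.dist z y = G.dist x y + 1 ∨ G.dist z y + 1 = G.dist x y := by
  have h1 := hbip.even_dist_add hc x z y
  have hxz : G.dist x z = 1 := dist_eq_one_iff_adj.2 h
  have h2 : G.dist x y ≤ G.dist x z + G.dist z y := hc.dist_triangle
  have h3 : G.dist z y ≤ G.dist z x + G.dist x y := hc.dist_triangle
  rw [G.dist_comm (u := z) (v := x)] at h3
  rw [hxz] at h1 h2 h3
  obtain ⟨m, hm⟩ := h1
  omega

theorem Connected.exists_adj_dist_eq (hc : G.Connected) {x y : V} {h : ℕ}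
    (hxy : G.dist x y = h + 1) : ∃ z, G.Adj x z ∧ G.dist z y = h := by
  obtain ⟨p, hp⟩ := hc.exists_walk_length_eq_dist x y
  rw [hxy] at hp
  cases p with
  | nil => simp at hp
  | @cons _ z _ hz q =>
    refine ⟨z, hz, ?_⟩
    rw [Walk.length_cons] at hp
    have h1 := G.dist_le q
    have h2 : G.dist x y ≤ G.dist x z + G.dist z y := hc.dist_triangle
    rw [dist_eq_one_iff_adj.2 hz] at h2
    omega

theorem Connected.dist_le_diam [Finite V] (hc : G.Connected) (x y : V) : G.dist x y ≤ G.diam := by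
  have := hc.nonempty
  exact SimpleGraph.dist_le_diam (connected_iff_ediam_ne_top.1 hc)

theorem Connected.exists_dist_eq [Finite V] (hc : G.Connected) {h : ℕ} (hh : h ≤ G.diam) :
    ∃ x y, G.dist x y = h := by
  have := hc.nonempty
  induction hh using Nat.decreasingInduction with
  | self => exact G.exists_dist_eq_diam
  | of_succ h _ ih =>
    obtain ⟨x, y, hxy⟩ := ih
    obtain ⟨z, -, hz⟩ := hc.exists_adj_dist_eq hxy
    exact ⟨z, y, hz⟩

/-! ### Functions of the distance and intersection numbers -/

section
open Classical
open scoped Finset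

variable [Fintype V]

theorem distCount_eq_card (x y : V) (i j : ℕ) :
    G.distCount x y i j = #{z : V | G.dist x z = i ∧ G.dist z y = j} := by
  rw [distCount, Set.ncard_eq_toFinset_card']
  congr 1
  ext; simp

theorem distCount_one_eq_card (x y : V) (j : ℕ) :
    G.distCount x y 1 j = #{z ∈ G.neighborFinset x | G.dist z y = j} := by
  rw [distCount_eq_card]
  congr 1
  ext; simp [dist_eq_one_iff_adj]

/-- The matrix whose entries are a function of the distance. -/
noncomputable def distMatrix (G : SimpleGraph V) (f : ℕ → ℝ) : Matrix V V ℝ := Matrix.of fun x y => f (G.dist x y)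

/-- The action of the adjacency matrix on functions of the distance. -/
noncomputable def distStep (G : SimpleGraph V) (f : ℕ → ℝ) : ℕ → ℝ
  | 0 => G.valency * f 1
  | h + 1 => G.interC (h + 1) * f h + G.interB (h + 1) * f (h + 2)

theorem IsDistanceRegular.sum_neighbor (hG : G.IsDistanceRegular) (hbip : G.IsBipartite)
    (f : ℕ → ℝ) (x y : V) :
    ∑ z ∈ G.neighborFinset x, f (G.dist z y) = G.distStep f (G.dist x y) := by
  rcases hh : G.dist x y with _ | h
  · have h1 : ∀ z ∈ G.neighborFinset x, f (G.dist z y) = if G.dist z y = 1 then f 1 else 0 := by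
      intro z hz
      rcases hbip.dist_adj hG.1 ((G.mem_neighborFinset x z).1 hz) y with h | h
      · rw [hh] at h; simp [h]
      · omega
    rw [Finset.sum_congr rfl h1, ← Finset.sum_filter, Finset.sum_const, ← distCount_one_eq_card,
      hG.distCount_eq hh, nsmul_eq_mul]
    rfl
  · have h1 : ∀ z ∈ G.neighborFinset x, f (G.dist z y) =
        (if G.dist z y = h then f h else 0) + (if G.dist z y = h + 2 then f (h + 2) else 0) := by
      intro z hz
      rcases hbip.dist_adj hG.1 ((G.mem_neighborFinset x z).1 hz) y with h' | h'
      · rw [hh] at h'; simp [h', show h + 1 + 1 ≠ h by omega]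
      · rw [hh] at h'
        obtain rfl : G.dist z y = h := by omega
        simp
    rw [Finset.sum_congr rfl h1, Finset.sum_add_distrib, ← Finset.sum_filter, ← Finset.sum_filter,
      Finset.sum_const, Finset.sum_const, ← distCount_one_eq_card, ← distCount_one_eq_card,
      hG.distCount_eq hh, hG.distCount_eq hh, nsmul_eq_mul, nsmul_eq_mul]
    rfl

theorem IsDistanceRegular.adjMatrix_mul_distMatrix (hG : G.IsDistanceRegular)
    (hbip : G.IsBipartite) (f : ℕ → ℝ) :
    G.adjMatrix ℝ * G.distMatrix f = G.distMatrix (G.distStep f) := by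
  ext x y
  rw [adjMatrix_mul_apply]
  exact hG.sum_neighbor hbip f x y

theorem IsDistanceRegular.card_neighborFinset (hG : G.IsDistanceRegular) (hbip : G.IsBipartite)
    (x : V) : (#(G.neighborFinset x) : ℝ) = G.valency := by
  have := hG.sum_neighbor hbip (fun _ => 1) x x
  simpa [distStep] using this

theorem IsDistanceRegular.interC_add_interB (hG : G.IsDistanceRegular) (hbip : G.IsBipartite)
    {h : ℕ} (h0 : 1 ≤ h) (hh : h ≤ G.diam) : G.interC h + G.interB h = G.valency := by
  obtain ⟨x, y, hxy⟩ := hG.1.exists_dist_eq hh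
  have h1 := hG.sum_neighbor hbip (fun _ => 1) x y
  have h2 := hG.card_neighborFinset hbip x
  obtain ⟨h, rfl⟩ : ∃ j, h = j + 1 := ⟨h - 1, by omega⟩
  rw [hxy] at h1
  simp only [Finset.sum_const, nsmul_eq_mul, mul_one, distStep] at h1
  rw [h2] at h1
  exact_mod_cast h1.symm

theorem IsDistanceRegular.interC_pos (hG : G.IsDistanceRegular) {h : ℕ} (h0 : 1 ≤ h)
    (hh : h ≤ G.diam) : 0 < G.interC h := by
  obtain ⟨x, y, hxy⟩ := hG.1.exists_dist_eq hh
  obtain ⟨h, rfl⟩ : ∃ j, h = j + 1 := ⟨h - 1, by omega⟩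
  obtain ⟨z, hz, hzy⟩ := hG.1.exists_adj_dist_eq hxy
  rw [interC, ← hG.distCount_eq hxy, distCount_one_eq_card, Finset.card_pos]
  exact ⟨z, by simp [hz, hzy]⟩

theorem IsDistanceRegular.interB_pos (hG : G.IsDistanceRegular) {h : ℕ} (hh : h < G.diam) :
    0 < G.interB h := by
  obtain ⟨x, y, hxy⟩ := hG.1.exists_dist_eq (Nat.succ_le_of_lt hh)
  obtain ⟨z, hz, hzy⟩ := hG.1.exists_adj_dist_eq hxy
  rw [interB, ← hG.distCount_eq hzy, distCount_one_eq_card, Finset.card_pos]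
  exact ⟨x, by simp [hz.symm, hxy]⟩

theorem IsDistanceRegular.interC_one (hG : G.IsDistanceRegular) (hh : 1 ≤ G.diam) :
    G.interC 1 = 1 := by
  obtain ⟨x, y, hxy⟩ := hG.1.exists_dist_eq hh
  rw [interC, ← hG.distCount_eq hxy, distCount_one_eq_card, Finset.card_eq_one]
  refine ⟨y, ?_⟩
  ext z
  have hadj := dist_eq_one_iff_adj.1 hxy
  simp only [tsub_self, Finset.mem_filter, mem_neighborFinset, hG.1.dist_eq_zero_iff,
    Finset.mem_singleton]
  exact ⟨And.right, fun h => ⟨h ▸ hadj, h⟩⟩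

theorem IsDistanceRegular.interC_two_le_interC_three (hG : G.IsDistanceRegular)
    (hbip : G.IsBipartite) (hD : 3 ≤ G.diam) : G.interC 2 ≤ G.interC 3 := by
  obtain ⟨x, y, hxy⟩ := hG.1.exists_dist_eq hD
  obtain ⟨z, hz, hzy⟩ := hG.1.exists_adj_dist_eq hxy
  have hyx : G.dist y x = 3 := by rwa [dist_comm]
  have hyz : G.dist y z = 2 := by rwa [dist_comm]
  rw [interC, interC, ← hG.distCount_eq hyz, ← hG.distCount_eq hyx, distCount_one_eq_card,
    distCount_one_eq_card]
  refine Finset.card_le_card fun w hw => ?_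
  simp only [Finset.mem_filter, mem_neighborFinset] at hw ⊢
  refine ⟨hw.1, ?_⟩
  have h1 : G.dist w x ≤ G.dist w z + G.dist z x := hG.1.dist_triangle
  rw [dist_eq_one_iff_adj.2 hz.symm] at h1
  rcases hbip.dist_adj hG.1 hw.1 x with h | h <;> omega

end

end SimpleGraph

/-! ### Polynomials in real symmetric matrices -/

namespace Matrix
open Polynomial

variable {n : Type*} [Fintype n] [DecidableEq n]

theorem aeval_diagonal (d : n → ℝ) (p : ℝ[X]) :
    aeval (diagonal d) p = diagonal fun i => p.eval (d i) := by
  have h := aeval_algHom_apply (diagonalAlgHom ℝ : (n → ℝ) →ₐ[ℝ] Matrix n n ℝ) d p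
  rw [diagonalAlgHom_apply] at h
  rw [h]
  simp only [diagonalAlgHom_apply]
  congr 1
  ext i
  simp

namespace IsHermitian

variable {A : Matrix n n ℝ} (hA : A.IsHermitian)

theorem aeval_eq (p : ℝ[X]) :
    aeval A p = Unitary.conjStarAlgAut ℝ _ hA.eigenvectorUnitary
      (diagonal fun i => p.eval (hA.eigenvalues i)) := by
  conv_lhs => rw [hA.spectral_theorem]
  rw [← aeval_diagonal]
  exact aeval_algHom_apply
    (Unitary.conjStarAlgAut ℝ _ hA.eigenvectorUnitary).toAlgEquiv.toAlgHom _ p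

theorem aeval_eq_zero {p : ℝ[X]} (h : ∀ i, p.eval (hA.eigenvalues i) = 0) : aeval A p = 0 := by
  rw [hA.aeval_eq]
  simp [h]

theorem trace_aeval (p : ℝ[X]) : (aeval A p).trace = ∑ i, p.eval (hA.eigenvalues i) := by
  rw [hA.aeval_eq, Unitary.conjStarAlgAut_apply, trace_mul_cycle]
  simp

end IsHermitian

theorem mem_roots_charpoly_iff {A : Matrix n n ℝ} {t : ℝ} :
    t ∈ A.charpoly.roots ↔ ∃ v, v ≠ 0 ∧ A *ᵥ v = t • v := by
  rw [mem_roots A.charpoly_monic.ne_zero, ← charpoly_mulVecLin,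
    ← Module.End.hasEigenvalue_iff_isRoot_charpoly]
  constructor
  · intro h
    obtain ⟨v, hv⟩ := h.exists_hasEigenvector
    exact ⟨v, hv.2, hv.apply_eq_smul⟩
  · rintro ⟨v, hv, h⟩
    exact Module.End.hasEigenvalue_of_hasEigenvector (x := v)
      ⟨Module.End.mem_eigenspace_iff.2 h, hv⟩

theorem aeval_mulVec_of_eigenvector {A : Matrix n n ℝ} {v : n → ℝ} {t : ℝ} (h : A *ᵥ v = t • v)
    (p : ℝ[X]) : (aeval A p) *ᵥ v = p.eval t • v := by
  induction p using Polynomial.induction_on' with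
  | add p q hp hq => simp [add_mulVec, hp, hq, add_smul]
  | monomial m a =>
    have : ∀ m, A ^ m *ᵥ v = t ^ m • v := by
      intro m
      induction m with
      | zero => simp
      | succ m ih => rw [pow_succ, ← mulVec_mulVec, h, mulVec_smul, ih, smul_smul, pow_succ, mul_comm]
    simp [aeval_monomial, this, Algebra.algebraMap_eq_smul_one, smul_mulVec, smul_smul]

end Matrix

/-! ### The spectrum of a bipartite distance-regular graph -/

namespace SimpleGraph

section
open Classical Polynomial
open scoped Finset Matrix

variable {V : Type*} [Fintype V] {G : SimpleGraph V}

/-- The finset of the eigenvalues of the adjacency matrix. -/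
noncomputable def distinctEigenvalues (G : SimpleGraph V) : Finset ℝ :=
  (G.adjMatrix ℝ).charpoly.roots.toFinset

theorem mem_distinctEigenvalues {t : ℝ} :
    t ∈ G.distinctEigenvalues ↔ ∃ v, v ≠ 0 ∧ G.adjMatrix ℝ *ᵥ v = t • v := by
  rw [distinctEigenvalues, Multiset.mem_toFinset, Matrix.mem_roots_charpoly_iff]

theorem eigenvalues_mem_distinctEigenvalues (i : V) :
    (G.isHermitian_adjMatrix ℝ).eigenvalues i ∈ G.distinctEigenvalues := by
  rw [distinctEigenvalues, Multiset.mem_toFinset,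
    (G.isHermitian_adjMatrix ℝ).roots_charpoly_eq_eigenvalues]
  simp

theorem aeval_adjMatrix_eq_zero {p : ℝ[X]} (h : ∀ t ∈ G.distinctEigenvalues, p.eval t = 0) :
    aeval (G.adjMatrix ℝ) p = 0 :=
  (G.isHermitian_adjMatrix ℝ).aeval_eq_zero fun i => h _ (G.eigenvalues_mem_distinctEigenvalues i)

theorem eval_eq_zero_of_aeval_adjMatrix {p : ℝ[X]} (h : aeval (G.adjMatrix ℝ) p = 0) {t : ℝ}
    (ht : t ∈ G.distinctEigenvalues) : p.eval t = 0 := by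
  obtain ⟨v, hv, h'⟩ := mem_distinctEigenvalues.1 ht
  have := Matrix.aeval_mulVec_of_eigenvector h' p
  rw [h, Matrix.zero_mulVec] at this
  exact (smul_eq_zero.1 this.symm).resolve_right hv

theorem IsDistanceRegular.adjMatrix_pow_eq (hG : G.IsDistanceRegular) (hbip : G.IsBipartite)
    (m : ℕ) :
    G.adjMatrix ℝ ^ m = G.distMatrix (G.distStep^[m] fun h => if h = 0 then 1 else 0) := by
  induction m with
  | zero =>
    ext x y
    simp [distMatrix, Matrix.one_apply, hG.1.dist_eq_zero_iff]
  | succ m ih => rw [pow_succ', ih, hG.adjMatrix_mul_distMatrix hbip, Function.iterate_succ_apply']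

theorem IsDistanceRegular.exists_aeval_eq_distMatrix (hG : G.IsDistanceRegular)
    (hbip : G.IsBipartite) (p : ℝ[X]) : ∃ f, aeval (G.adjMatrix ℝ) p = G.distMatrix f := by
  induction p using Polynomial.induction_on' with
  | add p q hp hq =>
    obtain ⟨f, hf⟩ := hp
    obtain ⟨g, hg⟩ := hq
    exact ⟨f + g, by rw [map_add, hf, hg]; rfl⟩
  | monomial m a =>
    refine ⟨a • (G.distStep^[m] fun h => if h = 0 then 1 else 0), ?_⟩
    rw [aeval_monomial, hG.adjMatrix_pow_eq hbip, ← Algebra.smul_def]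
    rfl

theorem adjMatrix_pow_apply_eq_zero {m : ℕ} {x y : V} (h : m < G.dist x y) :
    (G.adjMatrix ℝ ^ m) x y = 0 := by
  rw [adjMatrix_pow_apply_eq_card_walk, Nat.cast_eq_zero, Fintype.card_eq_zero_iff]
  refine ⟨fun p => ?_⟩
  have := G.dist_le p.1
  have := p.2
  simp only [Set.mem_ofPred_eq] at this
  omega

theorem Connected.adjMatrix_pow_dist_ne_zero (hc : G.Connected) (x y : V) :
    (G.adjMatrix ℝ ^ G.dist x y) x y ≠ 0 := by
  rw [adjMatrix_pow_apply_eq_card_walk, Nat.cast_ne_zero]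
  obtain ⟨p, hp⟩ := hc.exists_walk_length_eq_dist x y
  have : Nonempty {p : G.Walk x y | p.length = G.dist x y} := ⟨p, hp⟩
  exact Fintype.card_ne_zero

/-- At a pair of vertices whose distance is the degree of `p`, only the leading power of the
adjacency matrix has a nonzero entry. -/
theorem Connected.aeval_adjMatrix_ne_zero (hc : G.Connected) {p : ℝ[X]} (hp : p ≠ 0)
    (hdeg : p.natDegree ≤ G.diam) : aeval (G.adjMatrix ℝ) p ≠ 0 := by
  obtain ⟨x, y, hxy⟩ := hc.exists_dist_eq hdeg
  intro h
  have h1 := congrFun (congrFun h x) y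
  rw [aeval_eq_sum_range, Finset.sum_range_succ, Matrix.add_apply, Matrix.sum_apply,
    Finset.sum_eq_zero] at h1
  · rw [zero_add, Matrix.smul_apply, smul_eq_mul, Matrix.zero_apply, mul_eq_zero] at h1
    rcases h1 with h1 | h1
    · exact hp (leadingCoeff_eq_zero.1 h1)
    · rw [← hxy] at h1
      exact hc.adjMatrix_pow_dist_ne_zero x y h1
  · intro i hi
    rw [Matrix.smul_apply, adjMatrix_pow_apply_eq_zero, smul_zero]
    rw [hxy]
    exact Finset.mem_range.1 hi

/-- Dimension count: polynomials of degree at most `D + 1` form a space of dimension `D + 2`, while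
their values at the adjacency matrix are determined by one entry for each distance `0, …, D`. -/
theorem IsDistanceRegular.exists_annihilating (hG : G.IsDistanceRegular) (hbip : G.IsBipartite) :
    ∃ p : ℝ[X], p ≠ 0 ∧ p.natDegree ≤ G.diam + 1 ∧ aeval (G.adjMatrix ℝ) p = 0 := by
  have h1 : ∀ h : Fin (G.diam + 1), ∃ q : V × V, G.dist q.1 q.2 = h := fun h => by
    obtain ⟨x, y, hxy⟩ := hG.1.exists_dist_eq (Nat.lt_succ_iff.1 h.2)
    exact ⟨(x, y), hxy⟩
  choose q hq using h1
  let φ : degreeLT ℝ (G.diam + 2) →ₗ[ℝ] (Fin (G.diam + 1) → ℝ) :=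
    LinearMap.pi fun h => (Matrix.entryLinearMap ℝ ℝ (q h).1 (q h).2).comp
      ((aeval (G.adjMatrix ℝ)).toLinearMap.comp (degreeLT ℝ (G.diam + 2)).subtype)
  have hφ : LinearMap.ker (φ.comp (degreeLTEquiv ℝ (G.diam + 2)).symm.toLinearMap) ≠ ⊥ :=
    LinearMap.ker_ne_bot_of_finrank_lt (by simp)
  obtain ⟨c, hc, hc0⟩ := Submodule.exists_mem_ne_zero_of_ne_bot hφ
  set p := (degreeLTEquiv ℝ (G.diam + 2)).symm c with hp
  have hp0 : (p : ℝ[X]) ≠ 0 := by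
    rw [Ne, ZeroMemClass.coe_eq_zero, hp, LinearEquiv.map_eq_zero_iff]
    exact hc0
  refine ⟨p, hp0, ?_, ?_⟩
  · have := mem_degreeLT.1 p.2
    rw [← natDegree_lt_iff_degree_lt hp0] at this
    omega
  · obtain ⟨f, hf⟩ := hG.exists_aeval_eq_distMatrix hbip (p : ℝ[X])
    rw [hf]
    ext x y
    have h2 : φ p = 0 := hc
    have h3 := congrFun h2 ⟨G.dist x y, Nat.lt_succ_iff.2 (hG.1.dist_le_diam x y)⟩
    have h4 : aeval (G.adjMatrix ℝ) (p : ℝ[X]) (q _).1 (q _).2 = 0 := h3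
    rw [hf] at h4
    simpa [distMatrix, hq] using h4

/-- This puts the indices `1` and `D / 2` in range, so the default value in `theta` is never met
there. -/
theorem IsDistanceRegular.card_distinctEigenvalues (hG : G.IsDistanceRegular)
    (hbip : G.IsBipartite) : #G.distinctEigenvalues = G.diam + 1 := by
  apply le_antisymm
  · obtain ⟨p, hp, hdeg, h⟩ := hG.exists_annihilating hbip
    refine le_trans ?_ hdeg
    refine le_trans (Finset.card_le_card fun t ht => ?_) (p.roots.toFinset_card_le.trans p.card_roots')
    simp [hp, eval_eq_zero_of_aeval_adjMatrix h ht]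
  · by_contra! h
    have hmonic : (∏ t ∈ G.distinctEigenvalues, (X - C t)).Monic :=
      monic_prod_of_monic _ _ fun t _ => monic_X_sub_C t
    refine hG.1.aeval_adjMatrix_ne_zero hmonic.ne_zero ?_ (aeval_adjMatrix_eq_zero fun t ht => ?_)
    · rw [natDegree_prod_of_monic _ _ fun t _ => monic_X_sub_C t]
      simpa using Nat.lt_succ_iff.1 h
    · rw [eval_prod]
      exact Finset.prod_eq_zero ht (by simp)

/-- A positive multiple of the orthogonal projection to an eigenspace of the adjacency matrix. -/
theorem IsDistanceRegular.exists_posSemidef (hG : G.IsDistanceRegular) (hbip : G.IsBipartite)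
    {t : ℝ} (ht : t ∈ G.distinctEigenvalues) :
    ∃ f : ℕ → ℝ, 0 < f 0 ∧ (∀ h ≤ G.diam, G.distStep f h = t * f h) ∧
      (G.distMatrix f).PosSemidef := by
  set p : ℝ[X] := ∏ s ∈ G.distinctEigenvalues.erase t, (X - C s) with hp
  have hpt : p.eval t ≠ 0 := by
    rw [hp, eval_prod, Finset.prod_ne_zero_iff]
    intro s hs
    rw [Finset.mem_erase] at hs
    simpa [sub_eq_zero] using hs.1.symm
  set M := aeval (G.adjMatrix ℝ) p with hM
  obtain ⟨g, hg⟩ := hG.exists_aeval_eq_distMatrix hbip p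
  -- `p(A)` is a multiple of the projection, possibly a negative one; its square is a positive
  -- multiple.
  obtain ⟨f, hf⟩ := hG.exists_aeval_eq_distMatrix hbip (p * p)
  have hMH : M.conjTranspose = M := by
    ext x y
    rw [hM, hg]
    simp [distMatrix, dist_comm]
  have hQ : G.distMatrix f = M * M.conjTranspose := by rw [hMH, ← hf, map_mul]
  have hpsd : (G.distMatrix f).PosSemidef := hQ ▸ Matrix.posSemidef_self_mul_conjTranspose M
  refine ⟨f, ?_, ?_, hpsd⟩
  -- `f 0` is the squared norm of every row of `M`, so `f 0 = 0` would force `M = 0`, against `p(t)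
  -- ≠ 0`.
  · have hx : ∀ x, f 0 = ∑ z, M x z * M x z := fun x => by
      have : G.distMatrix f x x = (M * M.conjTranspose) x x := by rw [hQ]
      simpa [distMatrix, Matrix.mul_apply] using this
    obtain ⟨x⟩ := hG.1.nonempty
    refine lt_of_le_of_ne (by rw [hx x]; exact Finset.sum_nonneg fun z _ => mul_self_nonneg _) ?_
    intro h0
    refine hpt (eval_eq_zero_of_aeval_adjMatrix ?_ ht)
    ext x z
    have h1 := hx x
    rw [← h0, eq_comm, Finset.sum_eq_zero_iff_of_nonneg fun z _ => mul_self_nonneg _] at h1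
    simpa using h1 z (Finset.mem_univ z)
  · intro h hh
    obtain ⟨x, y, hxy⟩ := hG.1.exists_dist_eq hh
    have h0 : aeval (G.adjMatrix ℝ) ((X - C t) * (p * p)) = 0 := by
      refine aeval_adjMatrix_eq_zero fun s hs => ?_
      by_cases hst : s = t
      · simp [hst]
      · have : p.eval s = 0 := by
          rw [hp, eval_prod]
          exact Finset.prod_eq_zero (Finset.mem_erase.2 ⟨hst, hs⟩) (by simp)
        simp [this]
    rw [map_mul, hf, map_sub, aeval_X, aeval_C, sub_mul, sub_eq_zero,
      hG.adjMatrix_mul_distMatrix hbip, ← Algebra.smul_def] at h0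
    have h1 := congrFun (congrFun h0 x) y
    simpa [distMatrix, hxy] using h1

theorem IsDistanceRegular.valency_mem_distinctEigenvalues (hG : G.IsDistanceRegular)
    (hbip : G.IsBipartite) : (G.valency : ℝ) ∈ G.distinctEigenvalues := by
  obtain ⟨x⟩ := hG.1.nonempty
  refine mem_distinctEigenvalues.2 ⟨fun _ => 1, fun h => one_ne_zero (congrFun h x), ?_⟩
  ext y
  simp [adjMatrix_mulVec_apply, ← hG.card_neighborFinset hbip y]

/-- Changing the sign of an eigenvector on one colour class negates its eigenvalue. -/
theorem IsBipartite.neg_mem_distinctEigenvalues (hbip : G.IsBipartite) {t : ℝ}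
    (ht : t ∈ G.distinctEigenvalues) : -t ∈ G.distinctEigenvalues := by
  obtain ⟨c⟩ := hbip.exists_bool_coloring
  obtain ⟨v, hv, h⟩ := mem_distinctEigenvalues.1 ht
  let s : V → ℝ := fun x => if c x then 1 else -1
  have hs : ∀ x, s x ≠ 0 := fun x => by simp only [s]; split_ifs <;> simp
  refine mem_distinctEigenvalues.2 ⟨fun x => s x * v x, fun h0 => hv ?_, ?_⟩
  · ext x
    have := congrFun h0 x
    simpa [hs x] using this
  · ext x
    have h1 := congrFun h x
    rw [adjMatrix_mulVec_apply] at h1 ⊢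
    have h2 : ∀ y ∈ G.neighborFinset x, s y * v y = -s x * v y := fun y hy => by
      have := c.valid ((G.mem_neighborFinset x y).1 hy)
      simp only [s]
      cases hx : c x <;> cases hy : c y <;> simp_all
    rw [Finset.sum_congr rfl h2, ← Finset.mul_sum, h1]
    simp only [Pi.smul_apply, smul_eq_mul]
    ring

/-- The positive semidefinite matrix of `t`, restricted to two adjacent vertices, gives `|f 1| ≤ f
0`, while `k f 1 = t f 0`. -/
theorem IsDistanceRegular.abs_le_valency (hG : G.IsDistanceRegular)
    (hbip : G.IsBipartite) (hD : 1 ≤ G.diam) {t : ℝ} (ht : t ∈ G.distinctEigenvalues) :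
    |t| ≤ G.valency := by
  obtain ⟨f, hf0, hf, hpsd⟩ := hG.exists_posSemidef hbip ht
  obtain ⟨x, y, hxy⟩ := hG.1.exists_dist_eq hD
  have h0 : G.valency * f 1 = t * f 0 := hf 0 (by omega)
  have hne : x ≠ y := fun h => by simp [h] at hxy
  have h1 : |f 1| ≤ f 0 := by
    have key : ∀ e : ℝ, e ^ 2 = 1 → 0 ≤ f 0 + e * f 1 := fun e he => by
      have := hpsd.dotProduct_mulVec_nonneg (Pi.single x 1 + Pi.single y e)
      simp [Matrix.mulVec_add, add_dotProduct, dotProduct_add, distMatrix, hxy, dist_comm] at this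
      nlinarith
    rw [abs_le]
    constructor
    · linarith [key 1 (by norm_num)]
    · linarith [key (-1) (by norm_num)]
  have h2 : |t| * f 0 ≤ G.valency * f 0 := by
    rw [← abs_of_pos hf0, ← abs_mul, ← h0, abs_mul, abs_of_pos hf0, Nat.abs_cast]
    exact mul_le_mul_of_nonneg_left h1 (Nat.cast_nonneg _)
  exact le_of_mul_le_mul_right h2 hf0

/-! ### The inequalities `θ_d² < b_2 < θ_1²` -/

/-- The polynomial `(k² - X²)(b₂ - X²)`. -/
noncomputable def separatingPolynomial (G : SimpleGraph V) : ℝ[X] :=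
  (C ((G.valency : ℝ) ^ 2) - X ^ 2) * (C (G.interB 2 : ℝ) - X ^ 2)

theorem natDegree_separatingPolynomial {V : Type*} (G : SimpleGraph V) :
    G.separatingPolynomial.natDegree = 4 := by
  unfold separatingPolynomial
  compute_degree!

/-- Every diagonal entry vanishes, by `(A²)_{xx} = k` and `(A⁴)_{xx} = k² + k(k - 1)c_2`. -/
theorem IsDistanceRegular.trace_separatingPolynomial (hG : G.IsDistanceRegular)
    (hbip : G.IsBipartite) (hD : 4 ≤ G.diam) :
    (aeval (G.adjMatrix ℝ) G.separatingPolynomial).trace = 0 := by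
  have e1 : (G.interC 1 : ℝ) + G.interB 1 = G.valency := by
    exact_mod_cast hG.interC_add_interB hbip (by omega) (by omega)
  have e2 : (G.interC 2 : ℝ) + G.interB 2 = G.valency := by
    exact_mod_cast hG.interC_add_interB hbip (by omega) (by omega)
  rw [hG.interC_one (by omega), Nat.cast_one] at e1
  have h1 : aeval (G.adjMatrix ℝ) G.separatingPolynomial =
      ((G.valency : ℝ) ^ 2 * G.interB 2) • G.adjMatrix ℝ ^ 0
        - ((G.valency : ℝ) ^ 2 + G.interB 2) • G.adjMatrix ℝ ^ 2 + G.adjMatrix ℝ ^ 4 := by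
    have : G.separatingPolynomial = C ((G.valency : ℝ) ^ 2 * G.interB 2) * X ^ 0
        - C ((G.valency : ℝ) ^ 2 + G.interB 2) * X ^ 2 + X ^ 4 := by
      simp only [separatingPolynomial, C_mul, C_add]
      ring
    rw [this]
    simp only [map_add, map_sub, map_mul, aeval_C, map_pow, aeval_X, Algebra.smul_def]
  rw [h1]
  refine Finset.sum_eq_zero fun x _ => ?_
  simp only [Matrix.diag_apply, Matrix.add_apply, Matrix.sub_apply, Matrix.smul_apply,
    hG.adjMatrix_pow_eq hbip, distMatrix, Matrix.of_apply, dist_self, Function.iterate_succ,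
    Function.iterate_zero, Function.comp, distStep, smul_eq_mul, id, hG.interC_one (show 1 ≤ G.diam by omega)]
  norm_num
  rw [← e2, eq_sub_of_add_eq' e1, ← e2]
  ring

/-- The values at the eigenvalues sum to zero with multiplicity, but are not all zero because the
degree `4` is at most `D`. Hence both signs occur. -/
theorem IsDistanceRegular.exists_separatingPolynomial_ne_zero (hG : G.IsDistanceRegular)
    (hbip : G.IsBipartite) (hD : 4 ≤ G.diam) :
    (∃ t ∈ G.distinctEigenvalues, 0 < G.separatingPolynomial.eval t) ∧
      ∃ t ∈ G.distinctEigenvalues, G.separatingPolynomial.eval t < 0 := by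
  have hA := G.isHermitian_adjMatrix ℝ
  have htr := hG.trace_separatingPolynomial hbip hD
  rw [hA.trace_aeval] at htr
  have hne : aeval (G.adjMatrix ℝ) G.separatingPolynomial ≠ 0 := by
    refine hG.1.aeval_adjMatrix_ne_zero (fun h => ?_) (by rwa [natDegree_separatingPolynomial])
    have := G.natDegree_separatingPolynomial
    simp [h] at this
  constructor
  · by_contra! h
    refine hne (hA.aeval_eq_zero fun i => ?_)
    rw [Finset.sum_eq_zero_iff_of_nonpos fun i _ =>
      h _ (G.eigenvalues_mem_distinctEigenvalues i)] at htr
    exact htr i (Finset.mem_univ i)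
  · by_contra! h
    refine hne (hA.aeval_eq_zero fun i => ?_)
    rw [Finset.sum_eq_zero_iff_of_nonneg fun i _ =>
      h _ (G.eigenvalues_mem_distinctEigenvalues i)] at htr
    exact htr i (Finset.mem_univ i)

theorem eval_separatingPolynomial {V : Type*} (G : SimpleGraph V) (t : ℝ) :
    G.separatingPolynomial.eval t =
    ((G.valency : ℝ) ^ 2 - t ^ 2) * (G.interB 2 - t ^ 2) := by
  simp [separatingPolynomial]

theorem IsDistanceRegular.sq_le_valency_sq (hG : G.IsDistanceRegular)
    (hbip : G.IsBipartite) (hD : 1 ≤ G.diam) {t : ℝ} (ht : t ∈ G.distinctEigenvalues) :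
    t ^ 2 ≤ (G.valency : ℝ) ^ 2 :=
  sq_le_sq.2 (by rw [Nat.abs_cast]; exact hG.abs_le_valency hbip hD ht)

theorem IsDistanceRegular.exists_sq_lt_interB_two (hG : G.IsDistanceRegular)
    (hbip : G.IsBipartite) (hD : 4 ≤ G.diam) :
    ∃ t ∈ G.distinctEigenvalues, t ^ 2 < G.interB 2 := by
  obtain ⟨t, ht, h⟩ := (hG.exists_separatingPolynomial_ne_zero hbip hD).1
  refine ⟨t, ht, ?_⟩
  rw [eval_separatingPolynomial] at h
  have h1 := hG.sq_le_valency_sq hbip (by omega) ht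
  by_contra! h2
  nlinarith

theorem IsDistanceRegular.exists_interB_two_lt_sq (hG : G.IsDistanceRegular)
    (hbip : G.IsBipartite) (hD : 4 ≤ G.diam) :
    ∃ t ∈ G.distinctEigenvalues, (G.interB 2 : ℝ) < t ^ 2 ∧ t ^ 2 < (G.valency : ℝ) ^ 2 := by
  obtain ⟨t, ht, h⟩ := (hG.exists_separatingPolynomial_ne_zero hbip hD).2
  refine ⟨t, ht, ?_⟩
  rw [eval_separatingPolynomial] at h
  have h1 := hG.sq_le_valency_sq hbip (by omega) ht
  constructor <;> by_contra! h2 <;> nlinarith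

theorem theta_eq_getElem {i : ℕ} (hi : i < (G.distinctEigenvalues.sort (· ≥ ·)).length) :
    G.theta i = (G.distinctEigenvalues.sort (· ≥ ·))[i] :=
  List.getD_eq_getElem _ _ hi

theorem theta_mem {i : ℕ} (hi : i < #G.distinctEigenvalues) :
    G.theta i ∈ G.distinctEigenvalues := by
  rw [theta_eq_getElem (by simpa using hi)]
  exact (Finset.mem_sort _).1 (List.getElem_mem _)

theorem exists_theta_eq {t : ℝ} (ht : t ∈ G.distinctEigenvalues) :
    ∃ i < #G.distinctEigenvalues, G.theta i = t := by
  obtain ⟨i, hi, h⟩ := List.mem_iff_getElem.1 ((Finset.mem_sort (· ≥ ·)).2 ht)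
  exact ⟨i, by simpa using hi, by rw [theta_eq_getElem hi, h]⟩

theorem theta_lt_theta {i j : ℕ} (hij : i < j) (hj : j < #G.distinctEigenvalues) :
    G.theta j < G.theta i := by
  rw [theta_eq_getElem (by simpa using hj), theta_eq_getElem (by simpa using hij.trans hj)]
  have h : (⟨i, by simpa using hij.trans hj⟩ : Fin (G.distinctEigenvalues.sort (· ≥ ·)).length) <
    ⟨j, by simpa using hj⟩ := hij
  exact Finset.sortedGT_sort _ h

theorem theta_le_theta {i j : ℕ} (hij : i ≤ j) (hj : j < #G.distinctEigenvalues) :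
    G.theta j ≤ G.theta i := by
  rcases hij.eq_or_lt with rfl | h
  · rfl
  · exact (theta_lt_theta h hj).le

/-- Both sides, as functions of `i`, enumerate the spectrum increasingly, and such an enumeration is
unique. -/
theorem IsBipartite.theta_sub (hbip : G.IsBipartite) {i : ℕ} (hi : i < #G.distinctEigenvalues) :
    G.theta (#G.distinctEigenvalues - 1 - i) = -G.theta i := by
  set n := #G.distinctEigenvalues with hn
  let f : Fin n → ℝ := fun i => -G.theta i
  let g : Fin n → ℝ := fun i => G.theta (n - 1 - i)
  have hf : StrictMono f := fun i j hij => neg_lt_neg (theta_lt_theta hij j.2)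
  have hg : StrictMono g := fun i j hij =>
    theta_lt_theta (by have := j.2; have : (i : ℕ) < j := hij; omega) (by have := i.2; omega)
  have hfr : Set.range f = G.distinctEigenvalues := by
    ext t
    constructor
    · rintro ⟨i, rfl⟩
      exact hbip.neg_mem_distinctEigenvalues (theta_mem i.2)
    · intro ht
      obtain ⟨i, hi, h⟩ := exists_theta_eq (hbip.neg_mem_distinctEigenvalues ht)
      exact ⟨⟨i, hi⟩, by simp [f, h]⟩
  have hgr : Set.range g = G.distinctEigenvalues := by
    ext t
    constructor
    · rintro ⟨i, rfl⟩
      exact theta_mem (by have := i.2; omega)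
    · intro ht
      obtain ⟨i, hi, h⟩ := exists_theta_eq ht
      exact ⟨⟨n - 1 - i, by omega⟩, by simp only [g, ← h]; congr 1; omega⟩
  exact (congrFun ((StrictMono.range_inj hf hg).1 (hfr.trans hgr.symm)) ⟨i, hi⟩).symm

theorem IsDistanceRegular.theta_zero (hG : G.IsDistanceRegular) (hbip : G.IsBipartite)
    (hD : 1 ≤ G.diam) : G.theta 0 = G.valency := by
  have hcard := hG.card_distinctEigenvalues hbip
  obtain ⟨i, hi, h⟩ := exists_theta_eq (hG.valency_mem_distinctEigenvalues hbip)
  refine le_antisymm ?_ (h ▸ theta_le_theta (Nat.zero_le i) hi)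
  exact (le_abs_self _).trans (hG.abs_le_valency hbip hD (theta_mem (by omega)))

theorem IsDistanceRegular.theta_one_sq (hG : G.IsDistanceRegular) (hbip : G.IsBipartite)
    (hD : 4 ≤ G.diam) :
    (G.interB 2 : ℝ) < G.theta 1 ^ 2 ∧ G.theta 1 ^ 2 < (G.valency : ℝ) ^ 2 := by
  have hcard := hG.card_distinctEigenvalues hbip
  obtain ⟨t, ht, h1, h2⟩ := hG.exists_interB_two_lt_sq hbip hD
  have habs : |t| ∈ G.distinctEigenvalues := by
    rcases abs_choice t with h | h <;> rw [h]
    exacts [ht, hbip.neg_mem_distinctEigenvalues ht]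
  obtain ⟨i, hi, h⟩ := exists_theta_eq habs
  have h0 := hG.theta_zero hbip (by omega)
  have hi0 : 1 ≤ i := by
    by_contra! hi0
    obtain rfl : i = 0 := by omega
    rw [h0] at h
    rw [h, sq_abs] at h2
    exact lt_irrefl _ h2
  have h3 : |t| ≤ G.theta 1 := h ▸ theta_le_theta hi0 hi
  have h4 : G.theta 1 < G.valency := h0 ▸ theta_lt_theta one_pos (by omega)
  rw [← sq_abs t] at h1
  have h5 := abs_nonneg t
  constructor <;> nlinarith

/-- By the symmetry `θ_{D-i} = -θ_i`, `θ_d` is nonnegative and has the smallest square of all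
eigenvalues, so one eigenvalue with square below `b_2` suffices. -/
theorem IsDistanceRegular.theta_half_sq (hG : G.IsDistanceRegular) (hbip : G.IsBipartite)
    (hD : 4 ≤ G.diam) : G.theta (G.diam / 2) ^ 2 < G.interB 2 := by
  have hcard := hG.card_distinctEigenvalues hbip
  have hneg : ∀ i ≤ G.diam, G.theta (G.diam - i) = -G.theta i := fun i hi => by
    have := hbip.theta_sub (i := i) (by omega)
    rwa [hcard, Nat.add_sub_cancel] at this
  have h0 : 0 ≤ G.theta (G.diam / 2) := by
    have h1 := hneg (G.diam / 2) (by omega)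
    have h2 := theta_le_theta (G := G) (i := G.diam / 2) (j := G.diam - G.diam / 2)
      (by omega) (by omega)
    linarith
  obtain ⟨t, ht, h⟩ := hG.exists_sq_lt_interB_two hbip hD
  obtain ⟨i, hi, rfl⟩ := exists_theta_eq ht
  refine lt_of_le_of_lt ?_ h
  rcases le_or_gt i (G.diam / 2) with hi' | hi'
  · exact pow_le_pow_left₀ h0 (theta_le_theta hi' (by omega)) 2
  · rw [← neg_sq (G.theta i), ← hneg i (by omega)]
    exact pow_le_pow_left₀ h0 (theta_le_theta (by omega) (by omega)) 2

end

end SimpleGraph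

/-! ### Characteristic polynomials and invariant subspaces -/

namespace Matrix
open Polynomial

variable {m n : Type*} [Fintype m] [DecidableEq m] [Fintype n] [DecidableEq n]

/-- If the column space of `N` is invariant under the symmetric matrix `T`, then the characteristic
polynomial of `T` is the product of those of the restrictions to it and to its complement. -/
theorem exists_charpoly_eq_mul {T : Matrix n n ℝ} (hT : T.transpose = T) {N : Matrix n m ℝ}
    {B : Matrix m m ℝ} (h : T * N = N * B)
    (hinj : ∀ u, (N.transpose * N) *ᵥ u = 0 → u = 0) :
    ∃ q : ℝ[X], T.charpoly = B.charpoly * q ∧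
      ∀ t ∈ q.roots, ∃ w, w ≠ 0 ∧ N.transpose *ᵥ w = 0 ∧ T *ᵥ w = t • w := by
  set K := LinearMap.ker N.transpose.mulVecLin with hK
  have hmem : ∀ w, w ∈ K ↔ N.transpose *ᵥ w = 0 := fun w => by
    rw [hK, LinearMap.mem_ker, mulVecLin_apply]
  have hinv : ∀ w ∈ K, T.mulVecLin w ∈ K := by
    intro w hw
    rw [hmem] at hw ⊢
    have h' : N.transpose * T = B.transpose * N.transpose := by
      rw [← transpose_mul, ← h, transpose_mul, hT]
    rw [mulVecLin_apply, mulVec_mulVec, h', ← mulVec_mulVec, hw, mulVec_zero]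
  let TK : K →ₗ[ℝ] K := T.mulVecLin.restrict hinv
  -- Injectivity of `NᵀN` makes the whole space the direct sum of the column space of `N` and `ker
  -- Nᵀ`; `Φ` is this decomposition, and it conjugates `T` to `B ⊕ TK`.
  let Φ : ((m → ℝ) × K) →ₗ[ℝ] (n → ℝ) := N.mulVecLin.coprod K.subtype
  have hΦ : ∀ u w, Φ (u, w) = N *ᵥ u + w := fun u w => rfl
  have hΦi : Function.Injective Φ := by
    rw [injective_iff_map_eq_zero]
    rintro ⟨u, w⟩ huw
    rw [hΦ] at huw
    have h1 : u = 0 := hinj u (by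
      have := congrArg (N.transpose *ᵥ ·) huw
      simpa [mulVec_add, (hmem w).1 w.2] using this)
    subst h1
    have h2 : w = 0 := by simpa using huw
    rw [h2]; rfl
  have hΦs : Function.Surjective Φ := by
    have hs : Function.Surjective (N.transpose * N).mulVecLin := by
      rw [← LinearMap.injective_iff_surjective, injective_iff_map_eq_zero]
      exact hinj
    intro e
    obtain ⟨u, hu⟩ := hs (N.transpose *ᵥ e)
    rw [mulVecLin_apply, ← mulVec_mulVec] at hu
    exact ⟨(u, ⟨e - N *ᵥ u, by rw [hmem, mulVec_sub, hu, sub_self]⟩), by simp [hΦ]⟩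
  let e := LinearEquiv.ofBijective Φ ⟨hΦi, hΦs⟩
  have hconj : e.conj (B.mulVecLin.prodMap TK) = T.mulVecLin := by
    refine LinearMap.ext fun v => ?_
    obtain ⟨⟨u, w⟩, rfl⟩ := e.surjective v
    rw [LinearEquiv.conj_apply_apply, LinearEquiv.symm_apply_apply]
    change Φ (B *ᵥ u, TK w) = T *ᵥ Φ (u, w)
    rw [hΦ, hΦ, mulVec_add, mulVec_mulVec, mulVec_mulVec, h]
    rfl
  refine ⟨TK.charpoly, ?_, ?_⟩
  · rw [← charpoly_mulVecLin, ← hconj, LinearEquiv.charpoly_conj, LinearMap.charpoly_prodMap,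
      charpoly_mulVecLin]
  · intro t ht
    rw [mem_roots TK.charpoly_monic.ne_zero, ← Module.End.hasEigenvalue_iff_isRoot_charpoly] at ht
    obtain ⟨w, hw⟩ := ht.exists_hasEigenvector
    refine ⟨w, fun h0 => hw.2 (Subtype.ext h0), (hmem w).1 w.2, ?_⟩
    exact congrArg Subtype.val hw.apply_eq_smul

theorem roots_charpoly_smul_one_add [Nonempty n] (a b : ℝ) :
    (a • (1 : Matrix n n ℝ) + of fun _ _ => b).charpoly.roots =
      (a + Fintype.card n * b) ::ₘ Multiset.replicate (Fintype.card n - 1) a := by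
  have h1 : (a • (1 : Matrix n n ℝ) + of fun _ _ => b) =
      vecMulVec (fun _ => b) (fun _ => 1) - scalar n (-a) := by
    ext i j
    simp [vecMulVec_apply, Matrix.one_apply, diagonal_apply]
    split_ifs <;> ring
  obtain ⟨c, hc⟩ : ∃ c, Fintype.card n = c + 1 := ⟨_, (Nat.succ_pred Fintype.card_ne_zero).symm⟩
  have h2 : (a • (1 : Matrix n n ℝ) + of fun _ _ => b).charpoly =
      (X - C (a + Fintype.card n * b)) * (X - C a) ^ (Fintype.card n - 1) := by
    rw [h1, charpoly_sub_scalar, charpoly_vecMulVec, hc]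
    simp [dotProduct, hc, smul_eq_C_mul]
    ring
  rw [h2, roots_mul, roots_X_sub_C, roots_pow, roots_X_sub_C, Multiset.nsmul_singleton]
  · rfl
  · exact ((monic_X_sub_C _).mul ((monic_X_sub_C _).pow _)).ne_zero

theorem IsHermitian.sum_map_roots_charpoly {A : Matrix n n ℝ} (hA : A.IsHermitian) (p : ℝ[X]) :
    (A.charpoly.roots.map fun t => p.eval t).sum = (aeval A p).trace := by
  rw [hA.roots_charpoly_eq_eigenvalues, hA.trace_aeval, Multiset.map_map]
  rfl

end Matrix

/-! ### The local eigenvalues at a vertex -/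

namespace SimpleGraph

section
open Classical Polynomial
open scoped Finset Matrix

variable {V : Type*} [Fintype V] {G : SimpleGraph V}

theorem IsDistanceRegular.adjMatrix_mul_self (hG : G.IsDistanceRegular) (hbip : G.IsBipartite)
    (hD : 1 ≤ G.diam) : G.adjMatrix ℝ * G.adjMatrix ℝ =
      (G.valency : ℝ) • (1 : Matrix V V ℝ)
        + (G.interC 2 : ℝ) • G.distMatrix (fun h => if h = 2 then 1 else 0) := by
  rw [← pow_two, hG.adjMatrix_pow_eq hbip]
  ext x y
  simp only [distMatrix, Matrix.of_apply, Matrix.add_apply, Matrix.smul_apply, Matrix.one_apply,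
    ← hG.1.dist_eq_zero_iff, Function.iterate_succ, Function.iterate_zero, Function.comp, id]
  rcases G.dist x y with _ | _ | _ | h <;> simp [distStep, hG.interC_one hD]

theorem IsDistanceRegular.interC_two_mul_card (hG : G.IsDistanceRegular) (hbip : G.IsBipartite)
    (hD : 1 ≤ G.diam) (x : V) :
    (G.interC 2 : ℝ) * Fintype.card {y // G.dist x y = 2} = G.valency * (G.valency - 1) := by
  have e1 : (G.interC 1 : ℝ) + G.interB 1 = G.valency := by
    exact_mod_cast hG.interC_add_interB hbip le_rfl hD
  have h1 := congrArg (· * G.distMatrix fun _ => 1) (hG.adjMatrix_mul_self hbip hD)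
  simp only [Matrix.mul_assoc, hG.adjMatrix_mul_distMatrix hbip, Matrix.add_mul, Matrix.smul_mul,
    Matrix.one_mul] at h1
  have h2 := congrFun (congrFun h1 x) x
  simp [distMatrix, distStep, Matrix.mul_apply] at h2
  rw [e1] at h2
  rw [Fintype.card_subtype]
  linarith

/-- Multiply `A² = k I + c_2 A_2` by `A_2` and read the entry at a pair at distance `2`. -/
theorem IsDistanceRegular.interC_two_mul_intersectionNumber (hG : G.IsDistanceRegular)
    (hbip : G.IsBipartite) (hD : 2 ≤ G.diam) :
    (G.interC 2 : ℝ) * G.intersectionNumber 2 2 2 + G.valency =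
      G.interC 2 * G.interB 1 + G.interB 2 * G.interC 3 := by
  obtain ⟨x, y, hxy⟩ := hG.1.exists_dist_eq hD
  have h1 := congrArg (· * G.distMatrix fun h => if h = 2 then 1 else 0)
    (hG.adjMatrix_mul_self hbip (by omega))
  simp only [Matrix.mul_assoc, hG.adjMatrix_mul_distMatrix hbip, Matrix.add_mul, Matrix.smul_mul,
    Matrix.one_mul] at h1
  have h2 := congrFun (congrFun h1 x) y
  have h3 : (G.distMatrix (fun h => if h = 2 then 1 else 0) *
      G.distMatrix (fun h => if h = 2 then 1 else 0)) x y = G.intersectionNumber 2 2 2 := by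
    rw [← hG.distCount_eq hxy, distCount_eq_card]
    simp [distMatrix, Matrix.mul_apply, ← ite_and, Finset.filter_and, Finset.inter_comm]
  rw [Matrix.add_apply, Matrix.smul_apply, Matrix.smul_apply, h3] at h2
  simp [distMatrix, distStep, hxy] at h2
  linarith

/-- The adjacency matrix between the vertices at distance 2 from `x` and the neighbors of `x`. -/
noncomputable def localIncidence (G : SimpleGraph V) (x : V) :
    Matrix {y // G.dist x y = 2} {w // G.Adj x w} ℝ :=
  Matrix.of fun y w => if G.Adj w y then 1 else 0

theorem IsBipartite.sum_dist_two (hbip : G.IsBipartite) (hc : G.Connected) {x w : V}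
    (hw : G.Adj x w) (F : V → ℝ) :
    ∑ y : {y // G.dist x y = 2}, (if G.Adj w y then F y else 0) =
      ∑ y ∈ G.neighborFinset w, F y - F x := by
  rw [← Finset.sum_subtype {y | G.dist x y = 2} (by simp) fun y => if G.Adj w y then F y else 0,
    ← Finset.sum_filter, Finset.filter_filter, eq_sub_iff_add_eq', ← Finset.sum_insert (by simp)]
  refine Finset.sum_congr ?_ fun _ _ => rfl
  ext y
  simp only [Finset.mem_insert, Finset.mem_filter, Finset.mem_univ, true_and, mem_neighborFinset]
  constructor
  · rintro (rfl | h)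
    · exact hw.symm
    · exact h.2
  · intro h
    have h1 := hbip.dist_adj hc h x
    rw [G.dist_comm (u := w), dist_eq_one_iff_adj.2 hw, G.dist_comm] at h1
    rcases h1 with h1 | h1
    · exact Or.inr ⟨h1, h⟩
    · exact Or.inl (hc.dist_eq_zero_iff.1 (by omega)).symm

theorem card_adj_subtype (x : V) : Fintype.card {w // G.Adj x w} = #(G.neighborFinset x) := by
  rw [Fintype.card_subtype]
  congr 1
  ext; simp

theorem IsDistanceRegular.sum_localIncidence (hG : G.IsDistanceRegular) (hbip : G.IsBipartite)
    (x : V) (z : {y // G.dist x y = 2}) : ∑ w, G.localIncidence x z w = G.interC 2 := by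
  have h := hG.sum_neighbor hbip (fun h => if h = 1 then 1 else 0) x z
  rw [z.2] at h
  simp only [distStep, dist_eq_one_iff_adj] at h
  simp only [localIncidence, Matrix.of_apply]
  rw [← Finset.sum_subtype (G.neighborFinset x) (by simp)
    fun w : V => if G.Adj w z then (1 : ℝ) else 0, h]
  simp

theorem secondSubconstituent_adjMatrix_apply {V : Type*} {G : SimpleGraph V} (x : V)
    (y z : {y // G.dist x y = 2}) :
    (G.secondSubconstituent x).adjMatrix ℝ y z = if G.dist y.1 z = 2 then 1 else 0 := by
  rw [adjMatrix_apply]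
  exact if_congr Iff.rfl rfl rfl

/-- The matrix of `(G.secondSubconstituent x).adjMatrix ℝ` on the column space of
`G.localIncidence x`. -/
noncomputable def localQuotient (G : SimpleGraph V) (x : V) :
    Matrix {w // G.Adj x w} {w // G.Adj x w} ℝ :=
  ((G.interB 3 : ℝ) - 1) • (1 : Matrix {w // G.Adj x w} {w // G.Adj x w} ℝ)
    + Matrix.of fun _ _ => ((G.interC 3 : ℝ) - 1) / G.interC 2

/-- The `(z, w)` entry on the left counts the neighbours of `w`, other than `x`, at distance `2`
from `z`: `b_1 - 1 = (b_3 - 1) + (c_3 - 1)` if `z` and `w` are adjacent, and `c_3 - 1` if they are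
at distance `3`. -/
theorem IsDistanceRegular.secondSubconstituent_mul (hG : G.IsDistanceRegular)
    (hbip : G.IsBipartite) (hD : 4 ≤ G.diam) (x : V) :
    (G.secondSubconstituent x).adjMatrix ℝ * G.localIncidence x =
      G.localIncidence x * G.localQuotient x := by
  have e1 : (G.interC 1 : ℝ) + G.interB 1 = G.valency := by
    exact_mod_cast hG.interC_add_interB hbip (by omega) (by omega)
  have e3 : (G.interC 3 : ℝ) + G.interB 3 = G.valency := by
    exact_mod_cast hG.interC_add_interB hbip (by omega) (by omega)
  have hc2 : (G.interC 2 : ℝ) ≠ 0 := by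
    exact_mod_cast (hG.interC_pos (h := 2) (by omega) (by omega)).ne'
  rw [hG.interC_one (by omega), Nat.cast_one] at e1
  ext z w
  have hL : ((G.secondSubconstituent x).adjMatrix ℝ * G.localIncidence x) z w =
      G.distStep (fun h => if h = 2 then 1 else 0) (G.dist w.1 z) - 1 := by
    have h1 := hbip.sum_dist_two hG.1 w.2 fun y => if G.dist y z = 2 then 1 else 0
    rw [hG.sum_neighbor hbip (fun h => if h = 2 then 1 else 0), if_pos z.2] at h1
    rw [← h1, Matrix.mul_apply]
    refine Finset.sum_congr rfl fun y _ => ?_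
    simp only [localIncidence, secondSubconstituent_adjMatrix_apply, Matrix.of_apply, mul_ite,
      mul_one, mul_zero, G.dist_comm (u := z.1)]
  have hR : (G.localIncidence x * G.localQuotient x) z w =
      (G.interB 3 - 1) * G.localIncidence x z w + (G.interC 3 - 1) := by
    rw [localQuotient, Matrix.mul_add, Matrix.add_apply, Matrix.mul_smul, Matrix.mul_one, Matrix.smul_apply,
      smul_eq_mul, Matrix.mul_apply]
    simp only [Matrix.of_apply]
    rw [← Finset.sum_mul, hG.sum_localIncidence hbip, mul_div_cancel₀ _ hc2]
  rw [hL, hR]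
  have h2 := hbip.dist_adj hG.1 w.2 z
  rw [z.2] at h2
  rcases h2 with h2 | h2
  · have : ¬ G.Adj w z := fun h => by rw [dist_eq_one_iff_adj.2 h] at h2; omega
    simp [h2, distStep, localIncidence, this]
  · have h3 : G.dist w.1 z = 1 := by omega
    simp [h3, distStep, localIncidence, dist_eq_one_iff_adj.1 h3]
    linarith

/-- Entries count common neighbours other than `x`. The result is positive definite as `b_2 > 0` and
`c_2 ≥ 1`. -/
theorem IsDistanceRegular.localIncidence_transpose_mul (hG : G.IsDistanceRegular)
    (hbip : G.IsBipartite) (hD : 2 ≤ G.diam) (x : V) :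
    (G.localIncidence x)ᵀ * G.localIncidence x =
      (G.interB 2 : ℝ) • (1 : Matrix _ _ ℝ) + Matrix.of fun _ _ => (G.interC 2 : ℝ) - 1 := by
  have e2 : (G.interC 2 : ℝ) + G.interB 2 = G.valency := by
    exact_mod_cast hG.interC_add_interB hbip (by omega) (by omega)
  ext w w'
  have h1 := hbip.sum_dist_two hG.1 w.2 fun y => if G.dist y w' = 1 then 1 else 0
  rw [hG.sum_neighbor hbip (fun h => if h = 1 then 1 else 0),
    if_pos (dist_eq_one_iff_adj.2 w'.2)] at h1
  have hL : ((G.localIncidence x)ᵀ * G.localIncidence x) w w' =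
      G.distStep (fun h => if h = 1 then 1 else 0) (G.dist w.1 w') - 1 := by
    rw [← h1, Matrix.mul_apply]
    refine Finset.sum_congr rfl fun y _ => ?_
    simp only [localIncidence, Matrix.transpose_apply, Matrix.of_apply, dist_eq_one_iff_adj,
      mul_ite, mul_one, mul_zero, ← ite_and, G.adj_comm y, and_comm]
  rw [hL]
  have h2 := hbip.dist_adj hG.1 w.2 w'
  rw [dist_eq_one_iff_adj.2 w'.2] at h2
  rcases h2 with h2 | h2
  · have : w ≠ w' := fun h => by rw [h] at h2; simp at h2
    simp [h2, distStep, this]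
  · have h3 : G.dist w.1 w' = 0 := by omega
    have h4 : w = w' := Subtype.ext (hG.1.dist_eq_zero_iff.1 h3)
    simp [h4, distStep]
    linarith

theorem IsDistanceRegular.eq_zero_of_localIncidence (hG : G.IsDistanceRegular)
    (hbip : G.IsBipartite) (hD : 3 ≤ G.diam) (x : V) (u : {w // G.Adj x w} → ℝ)
    (hu : ((G.localIncidence x)ᵀ * G.localIncidence x) *ᵥ u = 0) : u = 0 := by
  rw [hG.localIncidence_transpose_mul hbip (by omega)] at hu
  have hb2 : (0 : ℝ) < G.interB 2 := by exact_mod_cast hG.interB_pos (by omega)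
  have hc2 : (1 : ℝ) ≤ G.interC 2 := by exact_mod_cast hG.interC_pos (h := 2) (by omega) (by omega)
  have h1 : ∀ w, G.interB 2 * u w + (G.interC 2 - 1) * ∑ w', u w' = 0 := fun w => by
    have := congrFun hu w
    rw [Matrix.add_mulVec, Matrix.smul_mulVec, Matrix.one_mulVec] at this
    simpa [Matrix.mulVec, dotProduct, ← Finset.mul_sum] using this
  have h2 : G.interB 2 * ∑ w, u w ^ 2 + (G.interC 2 - 1) * (∑ w', u w') ^ 2 = 0 := by
    have : ∑ w, u w * (G.interB 2 * u w + (G.interC 2 - 1) * ∑ w', u w') = 0 :=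
      Finset.sum_eq_zero fun w _ => by rw [h1, mul_zero]
    rw [← this]
    simp only [mul_add, Finset.sum_add_distrib, ← Finset.sum_mul]
    rw [Finset.mul_sum]
    congr 1
    · exact Finset.sum_congr rfl fun w _ => by ring
    · ring
  have h3 : ∑ w, u w ^ 2 = 0 := by
    have h4 : 0 ≤ ∑ w, u w ^ 2 := Finset.sum_nonneg fun w _ => sq_nonneg _
    have h5 : 0 ≤ (G.interC 2 - 1) * (∑ w', u w') ^ 2 :=
      mul_nonneg (by linarith) (sq_nonneg _)
    nlinarith
  rw [Finset.sum_eq_zero_iff_of_nonneg fun w _ => sq_nonneg _] at h3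
  ext w
  simpa using h3 w (Finset.mem_univ w)

theorem IsDistanceRegular.localEigenvalues_eq (hG : G.IsDistanceRegular)
    (hbip : G.IsBipartite) (hD : 4 ≤ G.diam) (x : V) :
    G.localEigenvalues x = ((G.intersectionNumber 2 2 2 : ℝ) ::ₘ
        Multiset.replicate (G.valency - 1) ((G.interB 3 : ℝ) - 1)) + G.remainingLocalEigenvalues x ∧
      ∀ t ∈ G.remainingLocalEigenvalues x, ∃ v, v ≠ 0 ∧ (G.localIncidence x)ᵀ *ᵥ v = 0 ∧
        (G.secondSubconstituent x).adjMatrix ℝ *ᵥ v = t • v := by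
  have hcard : Fintype.card {w // G.Adj x w} = G.valency := by
    rw [card_adj_subtype]
    exact_mod_cast hG.card_neighborFinset hbip x
  have hne : Nonempty {w // G.Adj x w} := by
    rw [← Fintype.card_pos_iff, hcard]
    exact hG.interB_pos (by omega)
  have e1 : (G.interC 1 : ℝ) + G.interB 1 = G.valency := by
    exact_mod_cast hG.interC_add_interB hbip (by omega) (by omega)
  have e2 : (G.interC 2 : ℝ) + G.interB 2 = G.valency := by
    exact_mod_cast hG.interC_add_interB hbip (by omega) (by omega)
  have e3 : (G.interC 3 : ℝ) + G.interB 3 = G.valency := by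
    exact_mod_cast hG.interC_add_interB hbip (by omega) (by omega)
  have ep := hG.interC_two_mul_intersectionNumber hbip (by omega)
  have hc2 : (G.interC 2 : ℝ) ≠ 0 := by
    exact_mod_cast (hG.interC_pos (h := 2) (by omega) (by omega)).ne'
  rw [hG.interC_one (by omega), Nat.cast_one] at e1
  obtain ⟨q, hq, hev⟩ := Matrix.exists_charpoly_eq_mul
    ((G.secondSubconstituent x).transpose_adjMatrix (α := ℝ)) (hG.secondSubconstituent_mul hbip hD x)
    (hG.eq_zero_of_localIncidence hbip (by omega) x)
  have hB : (G.localQuotient x).charpoly.roots = (G.intersectionNumber 2 2 2 : ℝ) ::ₘ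
      Multiset.replicate (G.valency - 1) ((G.interB 3 : ℝ) - 1) := by
    rw [localQuotient, Matrix.roots_charpoly_smul_one_add, hcard]
    congr 1
    -- What remains is `b_3 - 1 + k(c_3 - 1)/c_2 = p^2_{22}`.
    field_simp
    rw [← eq_sub_iff_add_eq'] at e2 e3 e1
    rw [e1, e2] at ep
    rw [e3]
    linarith
  have hloc : G.localEigenvalues x = (G.localQuotient x).charpoly.roots + q.roots := by
    rw [← roots_mul (hq ▸ (Matrix.charpoly_monic _).ne_zero), ← hq]
    rfl
  -- The truncated multiset subtraction is exact here, since the removed part is a summand.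
  have hrem : G.remainingLocalEigenvalues x = q.roots := by
    rw [remainingLocalEigenvalues, hloc, hB, add_tsub_cancel_left]
  rw [hrem, hloc, hB]
  exact ⟨rfl, hev⟩

/-- The rows of the incidence matrix all sum to `c_2 ≠ 0`, so the all-ones vector lies in its column
space. -/
theorem IsDistanceRegular.sum_eq_zero_of_localIncidence (hG : G.IsDistanceRegular)
    (hbip : G.IsBipartite) (hD : 2 ≤ G.diam) {x : V} {v : {y // G.dist x y = 2} → ℝ}
    (hv : (G.localIncidence x)ᵀ *ᵥ v = 0) : ∑ y, v y = 0 := by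
  have hc2 : (G.interC 2 : ℝ) ≠ 0 := by
    exact_mod_cast (hG.interC_pos (h := 2) (by omega) (by omega)).ne'
  have h1 : ∑ w, ((G.localIncidence x)ᵀ *ᵥ v) w = 0 := by simp [hv]
  simp only [Matrix.mulVec, dotProduct, Matrix.transpose_apply] at h1
  rw [Finset.sum_comm] at h1
  simp only [← Finset.sum_mul, hG.sum_localIncidence hbip, ← Finset.mul_sum] at h1
  exact (mul_eq_zero.1 h1).resolve_left hc2

theorem IsDistanceRegular.distMatrix_submatrix {V : Type*} {G : SimpleGraph V} (hG : G.IsDistanceRegular)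
    (hbip : G.IsBipartite) (f : ℕ → ℝ) (x : V) :
    (G.distMatrix f).submatrix (Subtype.val : {y // G.dist x y = 2} → V) Subtype.val =
      (f 0 - f 4) • (1 : Matrix _ _ ℝ)
        + (f 2 - f 4) • (G.secondSubconstituent x).adjMatrix ℝ + Matrix.of fun _ _ => f 4 := by
  ext y z
  simp only [Matrix.submatrix_apply, distMatrix, Matrix.of_apply, Matrix.add_apply,
    Matrix.smul_apply, secondSubconstituent_adjMatrix_apply, Matrix.one_apply, Subtype.ext_iff,
    ← hG.1.dist_eq_zero_iff, smul_eq_mul]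
  have h1 : G.dist y.1 z ≤ G.dist y.1 x + G.dist x z := hG.1.dist_triangle
  have h2 := hbip.even_dist_add hG.1 y.1 x z
  rw [G.dist_comm (u := y.1) (v := x), y.2, z.2] at h1 h2
  obtain ⟨m, hm⟩ := h2
  have h3 : G.dist y.1 z = 0 ∨ G.dist y.1 z = 2 ∨ G.dist y.1 z = 4 := by omega
  rcases h3 with h | h | h <;> simp [h]

/-! ### Bounds for the remaining local eigenvalues -/

theorem IsDistanceRegular.local_eigenvalue_bound (hG : G.IsDistanceRegular)
    (hbip : G.IsBipartite) (hD : 4 ≤ G.diam) {t : ℝ} (ht : t ∈ G.distinctEigenvalues)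
    (htk : t ^ 2 < (G.valency : ℝ) ^ 2) {x : V} {v : {y // G.dist x y = 2} → ℝ} (hv0 : v ≠ 0)
    (hv : (G.localIncidence x)ᵀ *ᵥ v = 0) {η : ℝ}
    (hη : (G.secondSubconstituent x).adjMatrix ℝ *ᵥ v = η • v) :
    0 ≤ (G.interB 2 : ℝ) * G.interB 3 + (t ^ 2 - G.interB 2) * (1 + η) := by
  obtain ⟨f, hf0, hf, hpsd⟩ := hG.exists_posSemidef hbip ht
  -- This is the quadratic form at `v` divided by `v ⬝ᵥ v`; the constant matrix contributes nothing
  -- because `v` sums to zero.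
  have hq : 0 ≤ f 0 + η * f 2 - (1 + η) * f 4 := by
    have h1 := (hpsd.submatrix (Subtype.val : {y // G.dist x y = 2} → V)).dotProduct_mulVec_nonneg v
    have hJ : (Matrix.of fun _ _ => f 4 : Matrix {y // G.dist x y = 2} {y // G.dist x y = 2} ℝ)
        *ᵥ v = 0 := by
      ext y
      simp [Matrix.mulVec, dotProduct, ← Finset.mul_sum,
        hG.sum_eq_zero_of_localIncidence hbip (by omega) hv]
    rw [hG.distMatrix_submatrix hbip, Matrix.add_mulVec, Matrix.add_mulVec, hJ, Matrix.smul_mulVec,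
      Matrix.smul_mulVec, hη, Matrix.one_mulVec, add_zero, dotProduct_add, dotProduct_smul,
      dotProduct_smul, dotProduct_smul, star_trivial] at h1
    have h2 : 0 < v ⬝ᵥ v := by
      refine lt_of_le_of_ne (Finset.sum_nonneg fun y _ => mul_self_nonneg _) fun h => hv0 ?_
      exact dotProduct_self_eq_zero.1 h.symm
    simp only [smul_eq_mul] at h1
    by_contra! h3
    nlinarith
  have e1 : (G.interC 1 : ℝ) + G.interB 1 = G.valency := by
    exact_mod_cast hG.interC_add_interB hbip (by omega) (by omega)
  have e2 : (G.interC 2 : ℝ) + G.interB 2 = G.valency := by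
    exact_mod_cast hG.interC_add_interB hbip (by omega) (by omega)
  have e3 : (G.interC 3 : ℝ) + G.interB 3 = G.valency := by
    exact_mod_cast hG.interC_add_interB hbip (by omega) (by omega)
  have hk : (0 : ℝ) < G.valency := by exact_mod_cast hG.interB_pos (h := 0) (by omega)
  have hb1 : (0 : ℝ) < G.interB 1 := by exact_mod_cast hG.interB_pos (by omega)
  have hb2 : (0 : ℝ) < G.interB 2 := by exact_mod_cast hG.interB_pos (by omega)
  have hb3 : (0 : ℝ) < G.interB 3 := by exact_mod_cast hG.interB_pos (by omega)
  have g0 : G.valency * f 1 = t * f 0 := hf 0 (by omega)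
  have g1 : G.interC 1 * f 0 + G.interB 1 * f 2 = t * f 1 := hf 1 (by omega)
  have g2 : G.interC 2 * f 1 + G.interB 2 * f 3 = t * f 2 := hf 2 (by omega)
  have g3 : G.interC 3 * f 2 + G.interB 3 * f 4 = t * f 3 := hf 3 (by omega)
  rw [hG.interC_one (by omega), Nat.cast_one] at e1 g1
  have hf2 : (G.valency : ℝ) * G.interB 1 * f 2 = (t ^ 2 - G.valency) * f 0 := by
    linear_combination (G.valency : ℝ) * g1 + t * g0
  have hf4 : (G.interB 2 : ℝ) * G.interB 3 * f 4 = (t ^ 2 - G.interC 2 * G.interB 1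
      - G.interB 2 * G.interC 3) * f 2 - G.interC 2 * f 0 := by
    linear_combination (G.interB 2 : ℝ) * g3 + t * g2 + G.interC 2 * g1
  -- The recurrence expresses `f 2` and `f 4` through `f 0`; the factor `k² - t²` then splits off
  -- and is positive by `htk`.
  have key : (G.valency : ℝ) * G.interB 1 * G.interB 2 * G.interB 3
      * (f 0 + η * f 2 - (1 + η) * f 4) = f 0 * ((G.valency : ℝ) ^ 2 - t ^ 2)
        * ((G.interB 2 : ℝ) * G.interB 3 + (t ^ 2 - G.interB 2) * (1 + η)) := by
    rw [← eq_sub_iff_add_eq] at e2 e3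
    rw [← eq_sub_iff_add_eq'] at e1
    rw [e2, e3] at hf4
    rw [e1] at hf4 hf2 ⊢
    linear_combination (-(1 + η) * G.valency * (G.valency - 1)) * hf4
      + (η * G.interB 2 * G.interB 3 - (1 + η) * (t ^ 2 - (G.valency - G.interB 2)
        * (G.valency - 1) - G.interB 2 * (G.valency - G.interB 3))) * hf2
  have hpos : 0 ≤ f 0 * ((G.valency : ℝ) ^ 2 - t ^ 2)
        * ((G.interB 2 : ℝ) * G.interB 3 + (t ^ 2 - G.interB 2) * (1 + η)) := by
    rw [← key]; positivity
  exact nonneg_of_mul_nonneg_right hpos (mul_pos hf0 (by linarith))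

/-- The factor `t² - b_2` is positive for `θ_1` and negative for `θ_d`, so the same inequality
bounds `η` from opposite sides. -/
theorem IsDistanceRegular.tilde_le_and_le_tilde (hG : G.IsDistanceRegular)
    (hbip : G.IsBipartite) (hD : 4 ≤ G.diam) {x : V} {η : ℝ}
    (hη : η ∈ G.remainingLocalEigenvalues x) :
    G.tilde (G.theta 1) ≤ η ∧ η ≤ G.tilde (G.theta (G.diam / 2)) := by
  have hcard := hG.card_distinctEigenvalues hbip
  obtain ⟨v, hv0, hv, h⟩ := (hG.localEigenvalues_eq hbip hD x).2 η hη
  obtain ⟨h1, h1k⟩ := hG.theta_one_sq hbip hD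
  have hd := hG.theta_half_sq hbip hD
  have hb1 := hG.local_eigenvalue_bound hbip hD (theta_mem (by omega)) h1k hv0 hv h
  have hb2 := hG.local_eigenvalue_bound hbip hD (theta_mem (i := G.diam / 2) (by omega))
    (by linarith) hv0 hv h
  constructor
  · have h2 : -((G.interB 2 : ℝ) * G.interB 3 / (G.theta 1 ^ 2 - G.interB 2)) ≤ 1 + η := by
      rw [← neg_div, div_le_iff₀ (by linarith)]
      linarith
    rw [tilde]; linarith
  · have h2 : (G.interB 2 : ℝ) * G.interB 3 / (G.theta (G.diam / 2) ^ 2 - G.interB 2)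
        ≤ -(1 + η) := by
      rw [div_le_iff_of_neg (by linarith)]
      linarith
    rw [tilde]; linarith

/-! ### Traces and the tautness equation -/

theorem IsDistanceRegular.trace_secondSubconstituent_sq (hG : G.IsDistanceRegular) (x : V) :
    ((G.secondSubconstituent x).adjMatrix ℝ ^ 2).trace =
      Fintype.card {y // G.dist x y = 2} * G.intersectionNumber 2 2 2 := by
  have h : ∀ z : {y // G.dist x y = 2}, ((G.secondSubconstituent x).adjMatrix ℝ ^ 2).diag z =
      G.intersectionNumber 2 2 2 := by
    intro z
    rw [Matrix.diag_apply, pow_two, Matrix.mul_apply, ← hG.distCount_eq z.2, distCount_eq_card,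
      ← Finset.filter_filter, Finset.natCast_card_filter,
      Finset.sum_subtype (p := fun y => G.dist x y = 2) _ (by simp)]
    refine Finset.sum_congr rfl fun y _ => ?_
    simp only [secondSubconstituent_adjMatrix_apply, G.dist_comm (u := z.1)]
    split_ifs <;> simp
  rw [Matrix.trace, Finset.sum_congr rfl fun z _ => h z]
  simp

theorem IsDistanceRegular.sum_localEigenvalues (hG : G.IsDistanceRegular) (x : V) (a b : ℝ) :
    ((G.localEigenvalues x).map fun η => (η - a) * (η - b)).sum =
      Fintype.card {y // G.dist x y = 2} * (G.intersectionNumber 2 2 2 + a * b) := by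
  have h := (isHermitian_adjMatrix ℝ (G.secondSubconstituent x)).sum_map_roots_charpoly
    (X ^ 2 - C (a + b) * X + C (a * b))
  have hp : aeval ((G.secondSubconstituent x).adjMatrix ℝ) (X ^ 2 - C (a + b) * X + C (a * b)) =
      (G.secondSubconstituent x).adjMatrix ℝ ^ 2 - (a + b) • (G.secondSubconstituent x).adjMatrix ℝ
        + (a * b) • (1 : Matrix _ _ ℝ) := by
    simp [Algebra.smul_def]
  rw [hp, Matrix.trace_add, Matrix.trace_sub, Matrix.trace_smul, trace_adjMatrix,
    hG.trace_secondSubconstituent_sq, Matrix.trace_smul, Matrix.trace_one] at h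
  calc _ = (((G.secondSubconstituent x).adjMatrix ℝ).charpoly.roots.map
        fun η => (X ^ 2 - C (a + b) * X + C (a * b)).eval η).sum := by
        congr 1
        refine Multiset.map_congr rfl fun η _ => ?_
        simp
        ring
    _ = _ := by
        rw [h]
        simp
        ring

/-- Needed to cancel the factor `b_2 - 1` in `tautness_identity`. If `b_2 = 1`, then `b_1 = c_2 =
c_3 = k - 1`, and the formula for `p^2_{22}` makes `c_2` divide `1`, so `k = 2`. -/
theorem IsDistanceRegular.interB_two_ne_one (hG : G.IsDistanceRegular) (hbip : G.IsBipartite)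
    (hD : 4 ≤ G.diam) (hk : 3 ≤ G.valency) : G.interB 2 ≠ 1 := by
  intro hb2
  have e1 := hG.interC_add_interB hbip (h := 1) (by omega) (by omega)
  have e2 := hG.interC_add_interB hbip (h := 2) (by omega) (by omega)
  have e3 := hG.interC_add_interB hbip (h := 3) (by omega) (by omega)
  have ep : G.interC 2 * G.intersectionNumber 2 2 2 + G.valency =
      G.interC 2 * G.interB 1 + G.interB 2 * G.interC 3 := by
    exact_mod_cast hG.interC_two_mul_intersectionNumber hbip (by omega)
  have h23 := hG.interC_two_le_interC_three hbip (by omega)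
  have hb3 := hG.interB_pos (h := 3) (by omega)
  rw [hG.interC_one (by omega)] at e1
  have h1 : G.interB 1 = G.interC 2 := by omega
  have h2 : G.interC 3 = G.interC 2 := by omega
  rw [hb2, h1, h2] at ep
  have h3 : G.interC 2 * G.intersectionNumber 2 2 2 + 1 = G.interC 2 * G.interC 2 := by omega
  have h4 : G.interC 2 ∣ 1 :=
    (Nat.dvd_add_right (Dvd.intro _ rfl)).1 (h3 ▸ Dvd.intro _ rfl)
  have := Nat.dvd_one.1 h4
  omega

/-- The sum over the remaining local eigenvalues that measures the failure of tautness. -/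
theorem IsDistanceRegular.sum_remainingLocalEigenvalues (hG : G.IsDistanceRegular)
    (hbip : G.IsBipartite) (hD : 4 ≤ G.diam) (x : V) (a b : ℝ) :
    ((G.remainingLocalEigenvalues x).map fun η => (η - a) * (η - b)).sum =
      Fintype.card {y // G.dist x y = 2} * (G.intersectionNumber 2 2 2 + a * b)
        - (G.intersectionNumber 2 2 2 - a) * (G.intersectionNumber 2 2 2 - b)
        - (G.valency - 1) * ((G.interB 3 - 1 - a) * (G.interB 3 - 1 - b)) := by
  have h := hG.sum_localEigenvalues x a b
  have hk : 1 ≤ G.valency := hG.interB_pos (h := 0) (by omega)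
  rw [(hG.localEigenvalues_eq hbip hD x).1] at h
  simp only [Multiset.map_add, Multiset.map_cons, Multiset.map_replicate, Multiset.sum_add,
    Multiset.sum_cons, Multiset.sum_replicate, nsmul_eq_mul, Nat.cast_sub hk, Nat.cast_one] at h
  linarith

/-- Here `n = k_2`, `p = p^2_{22}`, `s = θ_1²`, `t = θ_d²`, with `b_1`, `b_2`, `b_3` written as `k -
1`, `k - c₂`, `k - c₃`. The long factor on the left is the sum over the remaining local eigenvalues;
the one on the right is the difference of the two sides of the tautness equation. -/
theorem tautness_identity {k c₂ c₃ p n s t : ℝ} (hc₂ : c₂ ≠ 0) (hs : s - (k - c₂) ≠ 0)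
    (ht : t - (k - c₂) ≠ 0) (hn : c₂ * n = k * (k - 1))
    (hp : c₂ * p + k = c₂ * (k - 1) + (k - c₂) * c₃) :
    c₂ * (k - c₂ - 1) * (s - (k - c₂)) * (k - c₂ - t) *
      (n * (p + (-1 - (k - c₂) * (k - c₃) / (s - (k - c₂)))
          * (-1 - (k - c₂) * (k - c₃) / (t - (k - c₂))))
        - (p - (-1 - (k - c₂) * (k - c₃) / (s - (k - c₂))))
          * (p - (-1 - (k - c₂) * (k - c₃) / (t - (k - c₂))))
        - (k - 1) * ((k - c₃ - 1 - (-1 - (k - c₂) * (k - c₃) / (s - (k - c₂))))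
          * (k - c₃ - 1 - (-1 - (k - c₂) * (k - c₃) / (t - (k - c₂)))))) =
    -(k * (k - c₃)) * ((k - c₃) * ((k - c₂) * (k - 2) - (c₂ - 1) * s)
        * ((k - c₂) * (k - 2) - (c₂ - 1) * t)
      - (k - 1) * ((k - 2) * (c₃ - 1) - (c₂ - 1) * p) * (s - (k - c₂)) * (k - c₂ - t)) := by
  obtain rfl : n = k * (k - 1) / c₂ := by rw [eq_div_iff hc₂]; linarith
  obtain rfl : p = (c₂ * (k - 1) + (k - c₂) * c₃ - k) / c₂ := by rw [eq_div_iff hc₂]; linarith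
  obtain ⟨a, rfl⟩ : ∃ a, s = a + (k - c₂) := ⟨s - (k - c₂), by ring⟩
  obtain ⟨b, rfl⟩ : ∃ b, t = b + (k - c₂) := ⟨t - (k - c₂), by ring⟩
  simp only [add_sub_cancel_right] at hs ht ⊢
  field_simp
  ring

theorem IsDistanceRegular.isTaut_iff (hG : G.IsDistanceRegular) (hbip : G.IsBipartite)
    (hD : 4 ≤ G.diam) (hk : 3 ≤ G.valency) (x : V) :
    G.IsTaut ↔ G.tautDelta ≠ 0 ∧ ((G.remainingLocalEigenvalues x).map fun η =>
      (η - G.tilde (G.theta 1)) * (η - G.tilde (G.theta (G.diam / 2)))).sum = 0 := by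
  rw [IsTaut, and_congr_right_iff]
  intro _
  have e1 : (G.interC 1 : ℝ) + G.interB 1 = G.valency := by
    exact_mod_cast hG.interC_add_interB hbip (by omega) (by omega)
  have e2 : (G.interC 2 : ℝ) + G.interB 2 = G.valency := by
    exact_mod_cast hG.interC_add_interB hbip (by omega) (by omega)
  have e3 : (G.interC 3 : ℝ) + G.interB 3 = G.valency := by
    exact_mod_cast hG.interC_add_interB hbip (by omega) (by omega)
  have hk0 : (G.valency : ℝ) ≠ 0 := by exact_mod_cast (by omega : G.valency ≠ 0)
  have hc2 : (G.interC 2 : ℝ) ≠ 0 := by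
    exact_mod_cast (hG.interC_pos (h := 2) (by omega) (by omega)).ne'
  have hb2 : (G.interB 2 : ℝ) ≠ 1 := by exact_mod_cast hG.interB_two_ne_one hbip hD hk
  have hb3 : (G.interB 3 : ℝ) ≠ 0 := by
    exact_mod_cast (hG.interB_pos (h := 3) (by omega)).ne'
  have h1 := (hG.theta_one_sq hbip hD).1
  have hd := hG.theta_half_sq hbip hD
  have hn := hG.interC_two_mul_card hbip (by omega) x
  have hp := hG.interC_two_mul_intersectionNumber hbip (by omega)
  rw [hG.interC_one (by omega), Nat.cast_one] at e1
  rw [← eq_sub_iff_add_eq'] at e1 e2 e3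
  rw [hG.sum_remainingLocalEigenvalues hbip hD, tautDelta, tilde, tilde]
  rw [e1, e2] at hp
  rw [e2] at h1 hd hb2
  rw [e3] at hb3
  rw [e1, e2, e3]
  have key := tautness_identity hc2 (sub_ne_zero.2 h1.ne') (sub_ne_zero.2 hd.ne) hn hp
  have hl : (G.interC 2 : ℝ) * (G.valency - G.interC 2 - 1) * (G.theta 1 ^ 2
      - (G.valency - G.interC 2)) * (G.valency - G.interC 2 - G.theta (G.diam / 2) ^ 2) ≠ 0 :=
    mul_ne_zero (mul_ne_zero (mul_ne_zero hc2 (sub_ne_zero.2 hb2)) (sub_ne_zero.2 h1.ne'))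
      (sub_ne_zero.2 hd.ne')
  have hr : -((G.valency : ℝ) * (G.valency - G.interC 3)) ≠ 0 := neg_ne_zero.2 (mul_ne_zero hk0 hb3)
  rw [← sub_eq_zero, ← mul_eq_zero_iff_left hr, ← key, mul_eq_zero_iff_left hl]

/-- All terms are nonpositive by `tilde_le_and_le_tilde`, so the sum vanishes only if each term
does. -/
theorem IsDistanceRegular.isSpectrallyTautAt_iff (hG : G.IsDistanceRegular)
    (hbip : G.IsBipartite) (hD : 4 ≤ G.diam) (x : V) :
    G.IsSpectrallyTautAt x ↔ ((G.remainingLocalEigenvalues x).map fun η =>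
      (η - G.tilde (G.theta 1)) * (η - G.tilde (G.theta (G.diam / 2)))).sum = 0 := by
  constructor
  · intro h
    refine Multiset.sum_eq_zero fun r hr => ?_
    obtain ⟨η, hη, rfl⟩ := Multiset.mem_map.1 hr
    rcases h η hη with rfl | rfl <;> simp
  · intro h η hη
    have h1 : ((G.remainingLocalEigenvalues x).map fun η =>
        -((η - G.tilde (G.theta 1)) * (η - G.tilde (G.theta (G.diam / 2))))).sum = 0 := by
      rw [Multiset.sum_map_neg, h, neg_zero]
    have h2 := Multiset.all_zero_of_le_zero_le_of_sum_eq_zero (fun r hr => by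
      obtain ⟨η, hη, rfl⟩ := Multiset.mem_map.1 hr
      obtain ⟨ha, hb⟩ := hG.tilde_le_and_le_tilde hbip hD hη
      nlinarith) h1 _ (Multiset.mem_map_of_mem _ hη)
    simpa [sub_eq_zero] using h2

end

end SimpleGraph

theorem mainTheorem2 {V : Type*} [Fintype V] (G : SimpleGraph V)
    (hG : G.IsDistanceRegular) (hbip : G.IsBipartite)
    (hD : 4 ≤ G.diam) (hk : 3 ≤ G.valency) :
    List.TFAE [
      G.IsTaut,
      G.tautDelta ≠ 0 ∧ ∀ x : V, G.IsSpectrallyTautAt x,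
      G.tautDelta ≠ 0 ∧ ∃ x : V, G.IsSpectrallyTautAt x] := by
  have key : ∀ x, G.IsTaut ↔ G.tautDelta ≠ 0 ∧ G.IsSpectrallyTautAt x := fun x => by
    rw [hG.isTaut_iff hbip hD hk x, hG.isSpectrallyTautAt_iff hbip hD x]
  obtain ⟨x₀⟩ := hG.1.nonempty
  tfae_have 1 → 2 := fun h => ⟨h.1, fun x => ((key x).1 h).2⟩
  tfae_have 2 → 3 := fun h => ⟨h.1, x₀, h.2 x₀⟩
  tfae_have 3 → 1 := fun ⟨h, x, hx⟩ => (key x).2 ⟨h, hx⟩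
  tfae_finish
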